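/- Let $0<\beta\le 1$. There is a constant $C$ depending only on $\beta$ such that the following holds. For $i=1,2,3$ let $\Sigma_i$ be a bounded, relatively open subset of a surface $\Sigma_i^*\subset\mathbb{R}^3$ with $\operatorname{diam}\Sigma_i\le 1$ and $\Sigma_3\neq\emptyset$, such that: 1. $\Sigma_i^*=\{\sigma\in U_i : \Phi_i(\sigma)=0,\ \nabla\Phi_i(\sigma)\ne 0\}$ for an open convex set $U_i\subset\mathbb{R}^3$ with $\operatorname{dist}(\Sigma_i,U_i^c)\ge\operatorname{diam}\Sigma_i$ and a function $\Phi_i\in C^{1,\beta}(U_i)$, that is, $\Phi_i$ is differentiable in $U_i$ and $\nabla\Phi_i$ is locally $\beta$-Hölder continuous there; $\Sigma_i^*$ is oriented by a unit normal vector field $\mathfrak n_i$; 2. for all $\sigma\ne\tilde\sigma$ in $\Sigma_i^*$, $$\frac{|\mathfrak n_i(\sigma)-\mathfrak n_i(\tilde\sigma)|}{|\sigma-\tilde\sigma|^{\beta}}+\frac{|\mathfrak n_i(\sigma)\cdot(\sigma-\tilde\sigma)|}{|\sigma-\tilde\sigma|^{1+\beta}}\le 1;$$ 3. $\tfrac12\le\det\big(\mathfrak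 n_1(\sigma_1),\mathfrak n_2(\sigma_2),\mathfrak n_3(\sigma_3)\big)\le 1$ for all $(\sigma_1,\sigma_2,\sigma_3)\in\Sigma_1^*\times\Sigma_2^*\times\Sigma_3^*$. Let $\mu_i$ be the surface measure on $\Sigma_i$ and let $f\in L^2(\Sigma_1,\mu_1)$, $g\in L^2(\Sigma_2,\mu_2)$ be complex valued. Then the convolution $f\ast g$, that is, the distribution $$(f\ast g)(\psi)=\int_{\Sigma_1}\int_{\Sigma_2} f(x)\,g(y)\,\psi(x+y)\,d\mu_2(y)\,d\mu_1(x),\qquad \psi\in C_c^\infty(\mathbb{R}^3),$$ is (given by) an integrable function on $\mathbb{R}^3$, and for every $0<\varepsilon\le 1$ $$\|f\ast g\|_{L^2(\Sigma_3(\varepsilon))}\le C\sqrt{\varepsilon}\,\|f\|_{L^2(\Sigma_1)}\|g\|_{L^2(\Sigma_2)},$$ where $\Sigma_3(\varepsilon)=\{v\in\mathbb{R}^3 : \operatorname{dist}(v,\Sigma_3)\le\varepsilon\}$ carries Lebesgue measure. -/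

import Mathlib

open MeasureTheory
open scoped Topology ContDiff

/-- Euclidean three-space. -/
abbrev R3 : Type := EuclideanSpace ℝ (Fin 3)

/-- `Φ ∈ C^{1,β}(U)` for an open set `U`: `Φ` is differentiable in `U` and its gradient is
(locally) Hölder continuous in `U` with exponent `β`. -/
def IsC1Holder (β : ℝ) (Φ : R3 → ℝ) (U : Set R3) : Prop :=
  DifferentiableOn ℝ Φ U ∧
    ∀ x ∈ U, ∃ V ∈ 𝓝 x, ∃ K : ℝ, ∀ y ∈ V ∩ U, ∀ z ∈ V ∩ U,
      ‖gradient Φ y - gradient Φ z‖ ≤ K * ‖y - z‖ ^ β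

/-- `S` is a bounded, relatively open subset of the surface `S'`, which is the regular part of the
zero set of a `C^{1,β}` function `Φ` on an open convex set `U` with `dist(S, Uᶜ) ≥ diam S`, and
`n` is a unit normal vector field on `S'` (an orientation). The distance condition is written
pointwise, so that it is void for `U = ℝ³`. -/
def IsRegularSurface (β : ℝ) (S S' : Set R3) (n : R3 → R3) : Prop :=
  Bornology.IsBounded S ∧
  (∃ V : Set R3, IsOpen V ∧ S = S' ∩ V) ∧
  ∃ (U : Set R3) (Φ : R3 → ℝ),
    IsOpen U ∧ Convex ℝ U ∧ IsC1Holder β Φ U ∧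
    S' = {σ | σ ∈ U ∧ Φ σ = 0 ∧ gradient Φ σ ≠ 0} ∧
    (∀ x ∈ S, ∀ y ∉ U, Metric.diam S ≤ dist x y) ∧
    ∀ σ ∈ S', ‖n σ‖ = 1 ∧ ∃ c : ℝ, gradient Φ σ = c • n σ

/-- The scale invariant Hölder condition, with constant `b`, on the unit normal field `n` of
`S'`. -/
def NormalHolder (β b : ℝ) (S' : Set R3) (n : R3 → R3) : Prop :=
  ∀ σ ∈ S', ∀ τ ∈ S', σ ≠ τ →
    ‖n σ - n τ‖ / ‖σ - τ‖ ^ β + |inner ℝ (n σ) (σ - τ)| / ‖σ - τ‖ ^ (1 + β) ≤ b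

/-- The matrix with columns `n₁(σ₁)`, `n₂(σ₂)`, `n₃(σ₃)`. -/
def normalMatrix (n : Fin 3 → R3 → R3) (σ : Fin 3 → R3) : Matrix (Fin 3) (Fin 3) ℝ :=
  Matrix.of fun i j => n j (σ j) i

/-- The hypotheses on the triple of surfaces `S 0`, `S 1`, `S 2`, contained in larger surfaces
`S' i` with unit normal fields `n i`, with parameters `β`, `b`, `θ`. -/
structure SurfaceAssumption (β b θ : ℝ) (S S' : Fin 3 → Set R3) (n : Fin 3 → R3 → R3) :
    Prop where
  regular : ∀ i, IsRegularSurface β (S i) (S' i) (n i)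
  holder : ∀ i, NormalHolder β b (S' i) (n i)
  transversal : ∀ σ : Fin 3 → R3, (∀ i, σ i ∈ S' i) →
    θ ≤ (normalMatrix n σ).det ∧ (normalMatrix n σ).det ≤ 1

/-- The surface measure on `S`: the two-dimensional Hausdorff measure, normalized so as to agree
with Lebesgue measure on planes, restricted to `S`. -/
noncomputable def surfaceMeasure (S : Set R3) : Measure R3 :=
  (Measure.euclideanHausdorffMeasure 2 : Measure R3).restrict S

/-- The function `h ∈ L¹(ℝ³)` represents the convolution of `f` on `S₁` and `g` on `S₂`, that is,
the distribution `ψ ↦ ∫_{S₁} ∫_{S₂} f(x) g(y) ψ(x + y) dμ₂(y) dμ₁(x)`. Such an `h` is unique up to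
a null set. -/
def IsSurfaceConvolution (S₁ S₂ : Set R3) (f g h : R3 → ℂ) : Prop :=
  Integrable h volume ∧
    ∀ ψ : R3 → ℂ, ContDiff ℝ ∞ ψ → HasCompactSupport ψ →
      ∫ v, h v * ψ v =
        ∫ x, ∫ y, f x * g y * ψ (x + y) ∂(surfaceMeasure S₂) ∂(surfaceMeasure S₁)

/-!
Cover each surface by boundedly many pieces on which the unit normal is almost constant; such a
piece is almost a piece of a plane. By Cramer's rule and Hadamard's inequality, transversality of
the three normals `a i` gives `‖w‖ ≲ ∑ i, |⟪a i, w⟫|`, so the `δ`, `δ` and `ε`-neighbourhoods of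
translates of the three surfaces meet in a set of volume `≲ ε δ²` for `δ ≤ ε`, while balls of
radius `δ` have surface measure `≲ δ²`. Two applications of the Cauchy–Schwarz inequality then bound
the `L²` norm over `Σ₃(ε)` of the averages over `δ`-balls of the measure `P = |f| μ₁ ∗ |g| μ₂` by
`C √ε ‖f‖ ‖g‖`, uniformly in `δ`. As `Σ₃(R)` exhausts the space, `P` is absolutely continuous, and
letting `δ → 0` (Lebesgue differentiation and Fatou) the bound passes to its density. Finally
`f ∗ g` is this density times the conditional expectation of the phase of `f x * g y` given
`x + y`, which is bounded by `1`.
-/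

open scoped ENNReal NNReal

theorem abs_det_le_prod_norm {n : ℕ} (a : Fin n → EuclideanSpace ℝ (Fin n)) :
    |(Matrix.of fun i j ↦ a j i : Matrix (Fin n) (Fin n) ℝ).det| ≤ ∏ i, ‖a i‖ := by
  rcases n with _ | n
  · simp
  have : Fact (Module.finrank ℝ (EuclideanSpace ℝ (Fin (n + 1))) = n + 1) := ⟨by simp⟩
  let e := EuclideanSpace.basisFun (Fin (n + 1)) ℝ
  have h := e.toBasis.orientation.abs_volumeForm_apply_le a
  rwa [e.toBasis.orientation.volumeForm_robust' e, Module.Basis.det_apply] at h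

theorem abs_det_mul_norm_le {n : ℕ} (a : Fin n → EuclideanSpace ℝ (Fin n)) (ha : ∀ i, ‖a i‖ ≤ 1)
    (w : EuclideanSpace ℝ (Fin n)) :
    |(Matrix.of fun i j ↦ a j i : Matrix (Fin n) (Fin n) ℝ).det| * ‖w‖ ≤
      ∑ i, |inner ℝ (a i) w| := by
  set A : Matrix (Fin n) (Fin n) ℝ := Matrix.of fun i j ↦ a j i
  have hcol (i : Fin n) : |A.cramer w i| ≤ ‖w‖ := by
    have h := abs_det_le_prod_norm (Function.update a i w)
    have hu : Matrix.of (fun k j ↦ Function.update a i w j k) = A.updateCol i w := by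
      ext k j
      rcases eq_or_ne j i with rfl | hj <;> simp [A, *]
    rw [hu, ← Matrix.cramer_apply] at h
    refine h.trans ?_
    rw [← Finset.mul_prod_erase _ _ (Finset.mem_univ i), Function.update_self]
    refine mul_le_of_le_one_right (norm_nonneg w)
      (Finset.prod_le_one (fun _ _ ↦ norm_nonneg _) fun j hj ↦ ?_)
    rw [Function.update_of_ne (Finset.ne_of_mem_erase hj)]
    exact ha j
  have hcramer : ∑ i, A.cramer w i • a i = A.det • w := by
    ext k
    have := congrFun (A.mulVec_cramer w) k
    simpa [Matrix.mulVec, dotProduct, A, mul_comm] using this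
  rcases eq_or_ne w 0 with rfl | hw
  · simp
  refine le_of_mul_le_mul_right ?_ (norm_pos_iff.2 hw)
  calc |A.det| * ‖w‖ * ‖w‖ = |inner ℝ (A.det • w) w| := by
        rw [real_inner_smul_left, real_inner_self_eq_norm_sq, abs_mul, abs_sq]; ring
    _ = |∑ i, A.cramer w i * inner ℝ (a i) w| := by
        simp only [← hcramer, sum_inner, real_inner_smul_left]
    _ ≤ ∑ i, ‖w‖ * |inner ℝ (a i) w| := by
        refine (Finset.abs_sum_le_sum_abs _ _).trans (Finset.sum_le_sum fun i _ ↦ ?_)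
        rw [abs_mul]
        gcongr
        exact hcol i
    _ = (∑ i, |inner ℝ (a i) w|) * ‖w‖ := by rw [← Finset.mul_sum, mul_comm]

theorem measure_le_of_forall_slice_le {α : Type*} [MeasurableSpace α] (μ : Measure α) {A : Set α}
    {φ : α → ℝ} {L δ : ℝ} {M : ℝ≥0∞} (hδ : 0 < δ)
    (hφ : ∀ v ∈ A, ∀ w ∈ A, |φ v - φ w| ≤ L)
    (hM : ∀ B ⊆ A, (∀ v ∈ B, ∀ w ∈ B, |φ v - φ w| ≤ δ) → μ B ≤ M) :
    μ A ≤ ENNReal.ofReal (2 * L / δ + 2) * M := by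
  rcases A.eq_empty_or_nonempty with rfl | ⟨v₀, hv₀⟩
  · simp
  have hL : 0 ≤ L := (abs_nonneg _).trans (hφ v₀ hv₀ v₀ hv₀)
  let slice (k : ℤ) : Set α := {v ∈ A | ⌊φ v / δ⌋ = k}
  let K : Finset ℤ := Finset.Icc ⌊(φ v₀ - L) / δ⌋ ⌊(φ v₀ + L) / δ⌋
  have hcover : A ⊆ ⋃ k ∈ K, slice k := fun v hv ↦ by
    obtain ⟨h₁, h₂⟩ := abs_le.1 (hφ v hv v₀ hv₀)
    refine Set.mem_biUnion (x := ⌊φ v / δ⌋) (Finset.mem_Icc.2 ⟨?_, ?_⟩) ⟨hv, rfl⟩ <;>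
      exact Int.floor_le_floor (by gcongr; linarith)
  have hslice (k : ℤ) : μ (slice k) ≤ M := by
    refine hM _ (fun v hv ↦ hv.1) fun v hv w hw ↦ ?_
    have h := Int.abs_sub_lt_one_of_floor_eq_floor (hv.2.trans hw.2.symm)
    rw [← sub_div, abs_div, abs_of_pos hδ, div_lt_one hδ] at h
    exact h.le
  have hcard : (K.card : ℝ) ≤ 2 * L / δ + 2 := by
    have hle : ⌊(φ v₀ - L) / δ⌋ ≤ ⌊(φ v₀ + L) / δ⌋ + 1 :=
      (Int.floor_le_floor (by gcongr; linarith)).trans (lt_add_one _).le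
    have h : (K.card : ℝ) = ⌊(φ v₀ + L) / δ⌋ + 1 - ⌊(φ v₀ - L) / δ⌋ := by
      have := Int.card_Icc_of_le _ _ hle
      exact_mod_cast this
    rw [h, show 2 * L / δ = (φ v₀ + L) / δ - (φ v₀ - L) / δ by ring]
    linarith [Int.floor_le ((φ v₀ + L) / δ), Int.lt_floor_add_one ((φ v₀ - L) / δ)]
  calc μ A ≤ ∑ k ∈ K, μ (slice k) := (measure_mono hcover).trans (measure_biUnion_finset_le _ _)
    _ ≤ K.card * M := by
        rw [← nsmul_eq_mul]
        exact Finset.sum_le_card_nsmul _ _ _ fun k _ ↦ hslice k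
    _ ≤ ENNReal.ofReal (2 * L / δ + 2) * M := by
        gcongr
        exact (ENNReal.ofReal_natCast _).symm.trans_le (ENNReal.ofReal_le_ofReal hcard)

section AlmostFlat

variable {E : Type*} [NormedAddCommGroup E] [InnerProductSpace ℝ E]

/-- Up to the offset `r`, the set `A` is a graph of slope at most `η` over the orthogonal complement
of `m`. Almost flatness describes both small pieces of a surface with normal close to `m`, for
which `r = 0`, and the neighbourhoods of such pieces. -/
def IsAlmostFlat (m : E) (η r : ℝ) (A : Set E) : Prop :=
  ∀ v ∈ A, ∀ w ∈ A, |inner ℝ m (v - w)| ≤ η * ‖v - w‖ + r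

namespace IsAlmostFlat

variable {m : E} {η r : ℝ} {A B : Set E}

theorem subset (hA : IsAlmostFlat m η r A) (hBA : B ⊆ A) : IsAlmostFlat m η r B :=
  fun v hv w hw ↦ hA v (hBA hv) w (hBA hw)

theorem mono {r' : ℝ} (hA : IsAlmostFlat m η r A) (hr : r ≤ r') : IsAlmostFlat m η r' A :=
  fun v hv w hw ↦ (hA v hv w hw).trans (by gcongr)

theorem preimage_sub_right (hA : IsAlmostFlat m η r A) (x : E) :
    IsAlmostFlat m η r ((· - x) ⁻¹' A) := fun v hv w hw ↦ by
  simpa only [sub_sub_sub_cancel_right] using hA _ hv _ hw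

theorem thickening (hA : IsAlmostFlat m η r A) (hm : ‖m‖ ≤ 1) (hη : 0 ≤ η) (δ : ℝ) :
    IsAlmostFlat m η (r + 2 * (1 + η) * δ) (Metric.thickening δ A) := by
  intro v hv w hw
  obtain ⟨σ, hσA, hσ⟩ := Metric.mem_thickening_iff.1 hv
  obtain ⟨τ, hτA, hτ⟩ := Metric.mem_thickening_iff.1 hw
  rw [dist_eq_norm] at hσ hτ
  have hinner (u : E) : |inner ℝ m u| ≤ ‖u‖ :=
    (abs_real_inner_le_norm m u).trans (mul_le_of_le_one_left (norm_nonneg u) hm)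
  have hnorm : ‖σ - τ‖ ≤ ‖v - w‖ + 2 * δ := by
    rw [show σ - τ = (v - w) - (v - σ) + (w - τ) by abel]
    linarith [norm_add_le (v - w - (v - σ)) (w - τ), norm_sub_le (v - w) (v - σ)]
  calc |inner ℝ m (v - w)|
      = |inner ℝ m (σ - τ) + inner ℝ m (v - σ) - inner ℝ m (w - τ)| := by
        rw [← inner_add_right, ← inner_sub_right]; congr 2; abel
    _ ≤ |inner ℝ m (σ - τ)| + |inner ℝ m (v - σ)| + |inner ℝ m (w - τ)| :=
        (abs_sub _ _).trans (add_le_add_left (abs_add_le _ _) _)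
    _ ≤ (η * ‖σ - τ‖ + r) + δ + δ := by
        gcongr
        exacts [hA σ hσA τ hτA, (hinner _).trans hσ.le, (hinner _).trans hτ.le]
    _ ≤ (η * (‖v - w‖ + 2 * δ) + r) + δ + δ := by gcongr
    _ = η * ‖v - w‖ + (r + 2 * (1 + η) * δ) := by ring

theorem norm_sub_le_of_forall {ι : Type*} [Fintype ι] {a : ι → E} {θ : ℝ} (hθ : 0 < θ)
    (ha : ∀ w, θ * ‖w‖ ≤ ∑ i, |inner ℝ (a i) w|)
    (hA : ∀ i, IsAlmostFlat (a i) (θ / (2 * Fintype.card ι)) r A) {v w : E}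
    (hv : v ∈ A) (hw : w ∈ A) : ‖v - w‖ ≤ 2 * Fintype.card ι / θ * r := by
  have hsum : θ * ‖v - w‖ ≤ ∑ _i : ι, (θ / (2 * Fintype.card ι) * ‖v - w‖ + r) :=
    (ha _).trans (Finset.sum_le_sum fun i _ ↦ hA i v hv w hw)
  rcases isEmpty_or_nonempty ι with hι | hι
  · simp only [Finset.univ_eq_empty, Finset.sum_empty] at hsum
    simpa using nonpos_of_mul_nonpos_right hsum hθ
  rw [Finset.sum_const, Finset.card_univ, nsmul_eq_mul] at hsum
  have : (0 : ℝ) < Fintype.card ι := by exact_mod_cast Fintype.card_pos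
  field_simp at hsum ⊢
  linarith

variable [MeasurableSpace E] (μ : Measure E) [μ.IsAddLeftInvariant] {ι : Type*}
  [Fintype ι] {a : ι → E} {θ : ℝ}

theorem measure_le_measure_closedBall (hθ : 0 < θ) (ha : ∀ w, θ * ‖w‖ ≤ ∑ i, |inner ℝ (a i) w|)
    (hA : ∀ i, IsAlmostFlat (a i) (θ / (2 * Fintype.card ι)) r A) :
    μ A ≤ μ (Metric.closedBall 0 (2 * Fintype.card ι / θ * r)) := by
  rcases A.eq_empty_or_nonempty with rfl | ⟨p, hp⟩
  · simp
  calc μ A ≤ μ (Metric.closedBall p (2 * Fintype.card ι / θ * r)) := measure_mono fun v hv ↦ by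
        rw [mem_closedBall_iff_norm]
        exact norm_sub_le_of_forall hθ ha hA hv hp
    _ = μ (Metric.closedBall 0 (2 * Fintype.card ι / θ * r)) := by
        rw [← add_zero p, ← vadd_eq_add, ← Metric.vadd_closedBall, measure_vadd]

theorem measure_le (hθ : 0 < θ) (ha₁ : ∀ i, ‖a i‖ ≤ 1)
    (ha : ∀ w, θ * ‖w‖ ≤ ∑ i, |inner ℝ (a i) w|) {ε δ : ℝ} (hδ : 0 < δ) (hδε : δ ≤ ε) (j : ι)
    (hj : IsAlmostFlat (a j) (θ / (2 * Fintype.card ι)) ε A)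
    (hA : ∀ i ≠ j, IsAlmostFlat (a i) (θ / (2 * Fintype.card ι)) δ A) :
    μ A ≤ ENNReal.ofReal ((4 * Fintype.card ι / θ + 2) * (ε / δ)) *
      μ (Metric.closedBall 0 (2 * Fintype.card ι / θ * δ)) := by
  classical
  set κ : ℝ := 2 * Fintype.card ι / θ
  have : 0 < ε := hδ.trans_le hδε
  have hosc (v) (hv : v ∈ A) (w) (hw : w ∈ A) : |inner ℝ (a j) v - inner ℝ (a j) w| ≤ κ * ε := by
    rw [← inner_sub_right]
    refine (abs_real_inner_le_norm _ _).trans <|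
      (mul_le_of_le_one_left (norm_nonneg _) (ha₁ j)).trans ?_
    refine norm_sub_le_of_forall hθ ha (fun i ↦ ?_) hv hw
    rcases eq_or_ne i j with rfl | hij
    exacts [hj, (hA i hij).mono hδε]
  have hslice (B) (hBA : B ⊆ A)
      (hB : ∀ v ∈ B, ∀ w ∈ B, |inner ℝ (a j) v - inner ℝ (a j) w| ≤ δ) :
      μ B ≤ μ (Metric.closedBall 0 (κ * δ)) := by
    refine measure_le_measure_closedBall μ hθ ha fun i ↦ ?_
    rcases eq_or_ne i j with rfl | hij
    · intro v hv w hw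
      rw [inner_sub_right]
      exact (hB v hv w hw).trans (le_add_of_nonneg_left (by positivity))
    · exact (hA i hij).subset hBA
  refine (measure_le_of_forall_slice_le μ (φ := fun v ↦ inner ℝ (a j) v) hδ hosc hslice).trans ?_
  gcongr
  have : 1 ≤ ε / δ := (one_le_div hδ).2 hδε
  calc 2 * (κ * ε) / δ + 2 ≤ 2 * (κ * ε) / δ + 2 * (ε / δ) := by gcongr; linarith
    _ = (4 * Fintype.card ι / θ + 2) * (ε / δ) := by simp only [κ]; ring

end IsAlmostFlat

end AlmostFlat

theorem exists_card_le_subset_biUnion_closedBall {E : Type*} [NormedAddCommGroup E] [ProperSpace E]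
    {c : ℝ} (hc : 0 < c) (D : ℝ) :
    ∃ N : ℕ, ∀ S : Set E, Bornology.IsBounded S → Metric.diam S ≤ D →
      ∃ t : Finset E, ↑t ⊆ S ∧ t.card ≤ N ∧ S ⊆ ⋃ q ∈ t, Metric.closedBall q c := by
  lift c to ℝ≥0 using hc.le
  obtain ⟨C, hCD, hCfin, hC⟩ := Metric.exists_finite_isCover_of_isCompact
    (half_pos (NNReal.coe_pos.1 hc)).ne' (isCompact_closedBall (0 : E) D)
  obtain ⟨N, hN⟩ := ENat.ne_top_iff_exists.1 hCfin.encard_lt_top.ne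
  refine ⟨N, fun S hS hSD ↦ ?_⟩
  have hcov : Metric.coveringNumber c S ≤ N := by
    rcases S.eq_empty_or_nonempty with rfl | ⟨s, hs⟩
    · simp
    have hsub : S ⊆ (s + ·) '' Metric.closedBall 0 D := by
      rw [Set.image_add_left, preimage_add_closedBall, sub_neg_eq_add, zero_add]
      exact fun σ hσ ↦ (Metric.dist_le_diam_of_mem hS hσ hs).trans hSD
    calc Metric.coveringNumber c S
        ≤ Metric.coveringNumber (c / 2) ((s + ·) '' Metric.closedBall 0 D) :=
          Metric.coveringNumber_subset_le hsub
      _ = Metric.coveringNumber (c / 2) (Metric.closedBall (0 : E) D) :=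
          (isometry_add_left s).coveringNumber_image
      _ ≤ N := (hC.coveringNumber_le_encard hCD).trans_eq hN.symm
  obtain ⟨t, htS, htfin, ht, htcard⟩ := Metric.exists_set_encard_eq_coveringNumber
    (hcov.trans_lt (ENat.natCast_lt_top N)).ne
  lift t to Finset E using htfin
  rw [Set.encard_coe_eq_coe_finsetCard] at htcard
  exact ⟨t, htS, by exact_mod_cast htcard.trans_le hcov, by simpa using ht.subset_iUnion_closedBall⟩

namespace NormalHolder

variable {β b : ℝ} {S : Set R3} {n : R3 → R3}

theorem mono {S' : Set R3} (h : NormalHolder β b S' n) (hS : S ⊆ S') : NormalHolder β b S n :=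
  fun σ hσ τ hτ ↦ h σ (hS hσ) τ (hS hτ)

theorem norm_sub_le (h : NormalHolder β b S n) (hβ : β ≠ 0) {σ τ : R3} (hσ : σ ∈ S) (hτ : τ ∈ S) :
    ‖n σ - n τ‖ ≤ b * ‖σ - τ‖ ^ β := by
  rcases eq_or_ne σ τ with rfl | hne
  · simp [Real.zero_rpow hβ]
  have hpos : 0 < ‖σ - τ‖ := norm_pos_iff.2 (sub_ne_zero.2 hne)
  rw [← div_le_iff₀ (by positivity)]
  exact (le_add_of_nonneg_right (by positivity)).trans (h σ hσ τ hτ hne)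

theorem abs_inner_le (h : NormalHolder β b S n) {σ τ : R3} (hσ : σ ∈ S) (hτ : τ ∈ S) :
    |inner ℝ (n σ) (σ - τ)| ≤ b * ‖σ - τ‖ ^ β * ‖σ - τ‖ := by
  rcases eq_or_ne σ τ with rfl | hne
  · simp
  have hpos : 0 < ‖σ - τ‖ := norm_pos_iff.2 (sub_ne_zero.2 hne)
  rw [mul_assoc, ← Real.rpow_add_one hpos.ne', add_comm β, ← div_le_iff₀ (by positivity)]
  exact (le_add_of_nonneg_left (by positivity)).trans (h σ hσ τ hτ hne)

theorem exists_isAlmostFlat (hβ : 0 < β) (b : ℝ) {η : ℝ} (hη : 0 < η) :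
    ∃ c > 0, ∀ (S : Set R3) (n : R3 → R3), NormalHolder β b S n →
      ∀ p ∈ S, IsAlmostFlat (n p) η 0 (S ∩ Metric.closedBall p c) := by
  obtain ⟨c, hc, hcη⟩ : ∃ c > 0, |b| * (2 * c) ^ β < η / 2 := by
    have hlim : Filter.Tendsto (fun c : ℝ ↦ |b| * (2 * c) ^ β) (𝓝[>] 0) (𝓝 0) := by
      have hcont : Continuous fun c : ℝ ↦ |b| * (2 * c) ^ β := by fun_prop (disch := exact hβ.le)
      simpa [Real.zero_rpow hβ.ne'] using (hcont.tendsto 0).mono_left nhdsWithin_le_nhds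
    exact ((hlim.eventually_lt_const (half_pos hη)).and self_mem_nhdsWithin).exists.imp
      fun c hc ↦ ⟨hc.2, hc.1⟩
  refine ⟨c, hc, fun S n h p hp σ hσ τ hτ ↦ ?_⟩
  have hscale {x y : R3} (hx : x ∈ Metric.closedBall p c) (hy : y ∈ Metric.closedBall p c) :
      b * ‖x - y‖ ^ β ≤ η / 2 := by
    have hxy : ‖x - y‖ ≤ 2 * c := by
      rw [← dist_eq_norm]
      linarith [dist_triangle_right x y p, Metric.mem_closedBall.1 hx, Metric.mem_closedBall.1 hy]
    calc b * ‖x - y‖ ^ β ≤ |b| * (2 * c) ^ β := by gcongr; exact le_abs_self b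
      _ ≤ η / 2 := hcη.le
  calc |inner ℝ (n p) (σ - τ)|
      = |inner ℝ (n σ) (σ - τ) + inner ℝ (n p - n σ) (σ - τ)| := by
        rw [← inner_add_left, add_sub_cancel]
    _ ≤ |inner ℝ (n σ) (σ - τ)| + ‖n p - n σ‖ * ‖σ - τ‖ :=
        (abs_add_le _ _).trans (by gcongr; exact abs_real_inner_le_norm _ _)
    _ ≤ η / 2 * ‖σ - τ‖ + η / 2 * ‖σ - τ‖ := by
        gcongr
        · exact (h.abs_inner_le hσ.1 hτ.1).trans (by gcongr; exact hscale hσ.2 hτ.2)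
        · exact (h.norm_sub_le hβ.ne' hp hσ.1).trans
            (hscale (Metric.mem_closedBall_self hc.le) hσ.2)
    _ = η * ‖σ - τ‖ + 0 := by ring

end NormalHolder

theorem exists_volume_thickening_translates_le (d : ℕ) {θ : ℝ} (hθ : 0 < θ) :
    ∃ K : ℝ, 0 ≤ K ∧ ∀ (a : Fin d → EuclideanSpace ℝ (Fin d))
      (A : Fin d → Set (EuclideanSpace ℝ (Fin d))), (∀ i, ‖a i‖ ≤ 1) →
      θ ≤ |(Matrix.of fun i j ↦ a j i : Matrix (Fin d) (Fin d) ℝ).det| →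
      (∀ i, IsAlmostFlat (a i) (θ / (2 * d)) 0 (A i)) →
      ∀ (x : Fin d → EuclideanSpace ℝ (Fin d)) (j : Fin d) (ε δ : ℝ), 0 < δ → δ ≤ ε →
        volume {v | v - x j ∈ Metric.thickening ε (A j) ∧
          ∀ i ≠ j, v - x i ∈ Metric.thickening δ (A i)} ≤
          ENNReal.ofReal (K * ε * δ ^ (d - 1)) := by
  set η : ℝ := θ / (2 * d) with hη
  set κ : ℝ := 2 * d / θ * (2 * (1 + η)) with hκ
  set B : ℝ := volume.real (Metric.ball (0 : EuclideanSpace ℝ (Fin d)) 1)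
  have hη₀ : 0 ≤ η := by positivity
  refine ⟨(4 * d / θ + 2) * κ ^ d * B, by positivity,
    fun a A ha₁ hdet hA x j ε δ hδ hδε ↦ ?_⟩
  have hε : 0 < ε := hδ.trans_le hδε
  have ha (w : EuclideanSpace ℝ (Fin d)) : θ * ‖w‖ ≤ ∑ i, |inner ℝ (a i) w| :=
    le_trans (by gcongr) (abs_det_mul_norm_le a ha₁ w)
  have hflat (i : Fin d) (r : ℝ) :
      IsAlmostFlat (a i) η (2 * (1 + η) * r) ((· - x i) ⁻¹' Metric.thickening r (A i)) := by
    simpa only [zero_add] using ((hA i).thickening (ha₁ i) hη₀ r).preimage_sub_right (x i)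
  have hle := IsAlmostFlat.measure_le volume
    (A := {v | v - x j ∈ Metric.thickening ε (A j) ∧
      ∀ i ≠ j, v - x i ∈ Metric.thickening δ (A i)})
    hθ ha₁ ha (by positivity : 0 < 2 * (1 + η) * δ) (by gcongr : _ ≤ 2 * (1 + η) * ε) j
    (by rw [Fintype.card_fin]; exact (hflat j ε).subset fun v hv ↦ hv.1)
    (fun i hij ↦ by rw [Fintype.card_fin]; exact (hflat i δ).subset fun v hv ↦ hv.2 i hij)
  rw [Fintype.card_fin, ← mul_assoc, ← hκ, mul_div_mul_left _ _ (by positivity),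
    Measure.addHaar_closedBall _ _ (by positivity), finrank_euclideanSpace_fin,
    ← ofReal_measureReal Metric.isBounded_ball.measure_lt_top.ne,
    ← ENNReal.ofReal_mul (by positivity),
    ← ENNReal.ofReal_mul (by positivity)] at hle
  refine hle.trans_eq (congrArg ENNReal.ofReal ?_)
  obtain ⟨k, rfl⟩ := Nat.exists_eq_succ_of_ne_zero j.pos.ne'
  simp only [Nat.succ_eq_add_one, Nat.add_sub_cancel, pow_succ δ, mul_pow, B]
  field_simp

/-- Three bounded sets `S i`, of diameter at most `D`, with transversal unit vector fields `n i`.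
It is the second term of `NormalHolder` that makes `n i` normal to `S i`, so that the surfaces
containing the `S i` need not be mentioned. -/
structure TransversalTriple (β b θ D : ℝ) (S : Fin 3 → Set R3) (n : Fin 3 → R3 → R3) :
    Prop where
  isBounded : ∀ i, Bornology.IsBounded (S i)
  diam_le : ∀ i, Metric.diam (S i) ≤ D
  norm_eq_one : ∀ i, ∀ σ ∈ S i, ‖n i σ‖ = 1
  holder : ∀ i, NormalHolder β b (S i) (n i)
  transversal : ∀ σ : Fin 3 → R3, (∀ i, σ i ∈ S i) → θ ≤ |(normalMatrix n σ).det|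

theorem SurfaceAssumption.transversalTriple {β b θ D : ℝ} {S S' : Fin 3 → Set R3}
    {n : Fin 3 → R3 → R3} (h : SurfaceAssumption β b θ S S' n) (hD : ∀ i, Metric.diam (S i) ≤ D) :
    TransversalTriple β b θ D S n := by
  have hsub (i : Fin 3) : S i ⊆ S' i := by
    obtain ⟨-, ⟨V, -, hV⟩, -⟩ := h.regular i
    exact hV ▸ Set.inter_subset_left
  refine ⟨fun i ↦ (h.regular i).1, hD, fun i σ hσ ↦ ?_, fun i ↦ (h.holder i).mono (hsub i),
    fun σ hσ ↦ (h.transversal σ fun i ↦ hsub i (hσ i)).1.trans (le_abs_self _)⟩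
  obtain ⟨-, -, U, Φ, -, -, -, -, -, hn⟩ := h.regular i
  exact (hn σ (hsub i hσ)).1

theorem measure_le_of_subset_biUnion_piFinset {α ι κ : Type*} [MeasurableSpace α] [Fintype ι]
    [DecidableEq ι] (μ : Measure α) {t : ι → Finset κ} {N : ℕ} (ht : ∀ i, (t i).card ≤ N)
    {A : Set α} {P : (ι → κ) → Set α} {M : ℝ≥0∞} (hA : A ⊆ ⋃ q ∈ Fintype.piFinset t, P q)
    (hP : ∀ q ∈ Fintype.piFinset t, μ (P q) ≤ M) : μ A ≤ N ^ Fintype.card ι * M := by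
  calc μ A ≤ ∑ q ∈ Fintype.piFinset t, μ (P q) :=
        (measure_mono hA).trans (measure_biUnion_finset_le _ _)
    _ ≤ (Fintype.piFinset t).card * M := by
        rw [← nsmul_eq_mul]
        exact Finset.sum_le_card_nsmul _ _ _ hP
    _ ≤ N ^ Fintype.card ι * M := by
        gcongr
        rw [Fintype.card_piFinset]
        exact_mod_cast Finset.prod_le_pow_card _ _ _ fun i _ ↦ ht i

theorem exists_mem_thickening_inter_of_mem_cthickening {X ι : Type*} [PseudoEMetricSpace X]
    {S : Set X} {t : Finset ι} {B : ι → Set X} (hS : S ⊆ ⋃ q ∈ t, B q) {r r' : ℝ} (hr' : 0 < r')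
    (hrr' : r < r') {v : X} (hv : v ∈ Metric.cthickening r S) :
    ∃ q ∈ t, v ∈ Metric.thickening r' (S ∩ B q) := by
  have hv' := Metric.cthickening_subset_thickening' hr' hrr' _ hv
  rw [← Set.inter_eq_left.2 hS, Set.inter_iUnion₂] at hv'
  simpa only [Metric.thickening_iUnion, Set.mem_iUnion, exists_prop] using hv'

theorem TransversalTriple.exists_volume_translates_le {β θ : ℝ} (hβ : 0 < β) (hθ : 0 < θ)
    (b D : ℝ) :
    ∃ K : ℝ, 0 ≤ K ∧ ∀ (S : Fin 3 → Set R3) (n : Fin 3 → R3 → R3), TransversalTriple β b θ D S n →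
      ∀ (x : Fin 3 → R3) (j : Fin 3) (ε δ : ℝ), 0 < δ → δ ≤ ε →
        volume {v | v - x j ∈ Metric.cthickening ε (S j) ∧
          ∀ i ≠ j, v - x i ∈ Metric.cthickening δ (S i)} ≤ ENNReal.ofReal (K * ε * δ ^ 2) := by
  obtain ⟨c, hc, hflat⟩ :=
    NormalHolder.exists_isAlmostFlat hβ b (η := θ / (2 * (3 : ℕ))) (by positivity)
  obtain ⟨N, hN⟩ := exists_card_le_subset_biUnion_closedBall (E := R3) hc D
  obtain ⟨K, hK₀, hK⟩ := exists_volume_thickening_translates_le 3 hθ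
  refine ⟨N ^ 3 * (K * 2 ^ 3), by positivity, fun S n h x j ε δ hδ hδε ↦ ?_⟩
  choose t htS htN ht using fun i ↦ hN (S i) (h.isBounded i) (h.diam_le i)
  let P (q : Fin 3 → R3) : Set R3 :=
    {v | v - x j ∈ Metric.thickening (2 * ε) (S j ∩ Metric.closedBall (q j) c) ∧
      ∀ i ≠ j, v - x i ∈ Metric.thickening (2 * δ) (S i ∩ Metric.closedBall (q i) c)}
  have hpiece {i : Fin 3} {r : ℝ} (hr : 0 < r) {v : R3} (hv : v ∈ Metric.cthickening r (S i)) :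
      ∃ q ∈ t i, v ∈ Metric.thickening (2 * r) (S i ∩ Metric.closedBall q c) :=
    exists_mem_thickening_inter_of_mem_cthickening (ht i) (by positivity) (by linarith) hv
  have hcover : {v | v - x j ∈ Metric.cthickening ε (S j) ∧
      ∀ i ≠ j, v - x i ∈ Metric.cthickening δ (S i)} ⊆ ⋃ q ∈ Fintype.piFinset t, P q := by
    rintro v ⟨hvj, hv⟩
    choose! q hq hvq using fun i hij ↦ hpiece hδ (hv i hij)
    obtain ⟨p, hp, hvp⟩ := hpiece (hδ.trans_le hδε) hvj
    refine Set.mem_biUnion (x := Function.update q j p) (Fintype.mem_piFinset.2 fun i ↦ ?_)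
      ⟨by simpa, fun i hij ↦ by simpa [hij] using hvq i hij⟩
    rcases eq_or_ne i j with rfl | hij
    exacts [by simpa, by simpa [hij] using hq i hij]
  have hP (q : Fin 3 → R3) (hq : q ∈ Fintype.piFinset t) :
      volume (P q) ≤ ENNReal.ofReal (K * 2 ^ 3 * ε * δ ^ 2) := by
    have hqS (i : Fin 3) : q i ∈ S i := htS i (Fintype.mem_piFinset.1 hq i)
    refine (hK (fun i ↦ n i (q i)) _ (fun i ↦ (h.norm_eq_one i _ (hqS i)).le)
      (h.transversal q hqS) (fun i ↦ hflat _ _ (h.holder i) _ (hqS i)) x j (2 * ε) (2 * δ)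
      (by positivity) (by gcongr)).trans_eq ?_
    congr 1
    ring
  refine (measure_le_of_subset_biUnion_piFinset volume htN hcover hP).trans_eq ?_
  rw [Fintype.card_fin, ← Nat.cast_pow, ← ENNReal.ofReal_natCast,
    ← ENNReal.ofReal_mul (by positivity)]
  push_cast
  congr 1
  ring

theorem euclideanHausdorffMeasure_le_of_antilipschitzWith_domRestrict {X Y : Type*} [EMetricSpace X]
    [MeasurableSpace X] [BorelSpace X] [EMetricSpace Y] [MeasurableSpace Y] [BorelSpace Y]
    {A : Set X} {f : X → Y} {K : ℝ≥0} (hf : AntilipschitzWith K (A.domRestrict f)) (d : ℕ) :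
    μHE[d] A ≤ K ^ d * μHE[d] (f '' A) := by
  have h := hf.le_hausdorffMeasure_image d.cast_nonneg Set.univ
  rw [ENNReal.rpow_natCast, Set.image_univ, Set.range_domRestrict] at h
  rw [← Subtype.coe_image_univ A, isometry_subtype_coe.euclideanHausdorffMeasure_image,
    Subtype.coe_image_univ]
  simp only [Measure.euclideanHausdorffMeasure_def, Measure.smul_apply, ENNReal.smul_def,
    smul_eq_mul]
  rw [mul_left_comm]
  gcongr

namespace IsAlmostFlat

variable {E : Type*} [NormedAddCommGroup E] [InnerProductSpace ℝ E] {m : E} {A : Set E}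

theorem antilipschitzWith_orthogonalProjectionOnto (hm : ‖m‖ = 1)
    (hA : IsAlmostFlat m (1 / 2) 0 A) :
    AntilipschitzWith 2 (A.domRestrict (ℝ ∙ m)ᗮ.orthogonalProjectionOnto) := by
  refine AntilipschitzWith.of_le_mul_dist fun σ τ ↦ ?_
  rw [Subtype.dist_eq, dist_eq_norm, dist_eq_norm, Set.domRestrict_apply, Set.domRestrict_apply,
    ← map_sub]
  set w : E := σ - τ
  have hpyth : ‖w‖ ^ 2 =
      inner ℝ m w ^ 2 + ‖(ℝ ∙ m)ᗮ.orthogonalProjectionOnto w‖ ^ 2 := by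
    rw [(ℝ ∙ m).norm_sq_eq_add_norm_sq_projection w, ← Submodule.norm_coe,
      Submodule.coe_orthogonalProjectionOnto_apply, Submodule.starProjection_unit_singleton ℝ hm,
      norm_smul, hm, mul_one, Real.norm_eq_abs, sq_abs]
  have hinner : inner ℝ m w ^ 2 ≤ (1 / 2 * ‖w‖) ^ 2 :=
    sq_le_sq.2 <| (hA _ σ.2 _ τ.2).trans (by rw [add_zero]; exact le_abs_self _)
  rw [NNReal.coe_ofNat]
  refine le_of_sq_le_sq ?_ (by positivity)
  nlinarith [sq_nonneg ‖w‖]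

theorem euclideanHausdorffMeasure_inter_closedBall_le [MeasurableSpace E] [BorelSpace E] {k : ℕ}
    [NeZero k] [Fact (Module.finrank ℝ E = k + 1)] (hm : ‖m‖ = 1)
    (hA : IsAlmostFlat m (1 / 2) 0 A) (p : E) {r : ℝ} (hr : 0 ≤ r) :
    μHE[k] (A ∩ Metric.closedBall p r) ≤
      ENNReal.ofReal (2 ^ k * (√Real.pi ^ k / Real.Gamma (k / 2 + 1)) * r ^ k) := by
  have : FiniteDimensional ℝ E := .of_fact_finrank_eq_succ k
  have hdim : Module.finrank ℝ (ℝ ∙ m)ᗮ = k :=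
    Submodule.finrank_orthogonal_span_singleton (norm_ne_zero_iff.1 (hm.trans_ne one_ne_zero))
  have : Nontrivial (ℝ ∙ m)ᗮ := Module.nontrivial_of_finrank_pos (R := ℝ) (hdim ▸ NeZero.pos k)
  set P := (ℝ ∙ m)ᗮ.orthogonalProjectionOnto
  have himage : P '' (A ∩ Metric.closedBall p r) ⊆ Metric.closedBall (P p) r := by
    rintro _ ⟨σ, ⟨-, hσ⟩, rfl⟩
    rw [mem_closedBall_iff_norm] at hσ ⊢
    rw [← map_sub]
    exact ((ℝ ∙ m)ᗮ.norm_orthogonalProjectionOnto_apply_le _).trans hσ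
  calc μHE[k] (A ∩ Metric.closedBall p r)
      ≤ (2 : ℝ≥0) ^ k * μHE[k] (P '' (A ∩ Metric.closedBall p r)) :=
        euclideanHausdorffMeasure_le_of_antilipschitzWith_domRestrict
          ((hA.subset Set.inter_subset_left).antilipschitzWith_orthogonalProjectionOnto hm) k
    _ ≤ (2 : ℝ≥0) ^ k * volume (Metric.closedBall (P p) r) := by
        have hvol : (μHE[k] : Measure (ℝ ∙ m)ᗮ) = volume := by
          simpa only [hdim] using
            InnerProductSpace.euclideanHausdorffMeasure_eq_volume (V := (ℝ ∙ m)ᗮ)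
        rw [hvol]
        gcongr
    _ = _ := by
        rw [InnerProductSpace.volume_closedBall, hdim, ← ENNReal.ofReal_pow hr,
          ← ENNReal.ofReal_mul (by positivity), ENNReal.coe_ofNat, ← ENNReal.ofReal_ofNat,
          ← ENNReal.ofReal_pow zero_le_two, ← ENNReal.ofReal_mul (by positivity)]
        congr 1
        ring

end IsAlmostFlat

theorem NormalHolder.exists_surfaceMeasure_closedBall_le {β : ℝ} (hβ : 0 < β) (b : ℝ) :
    ∃ c > 0, ∃ K : ℝ, 0 ≤ K ∧ ∀ (S : Set R3) (n : R3 → R3), NormalHolder β b S n →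
      (∀ σ ∈ S, ‖n σ‖ = 1) → ∀ (p : R3) (r : ℝ), 0 ≤ r → r ≤ c →
        surfaceMeasure S (Metric.closedBall p r) ≤ ENNReal.ofReal (K * r ^ 2) := by
  obtain ⟨c, hc, hflat⟩ := exists_isAlmostFlat hβ b one_half_pos
  refine ⟨c / 2, half_pos hc, 2 ^ 2 * (√Real.pi ^ 2 / Real.Gamma ((2 : ℕ) / 2 + 1)),
    by positivity, fun S n h hn p r hr hrc ↦ ?_⟩
  rw [surfaceMeasure, Measure.restrict_apply Metric.isClosed_closedBall.measurableSet,
    Set.inter_comm]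
  rcases (S ∩ Metric.closedBall p r).eq_empty_or_nonempty with hempty | ⟨σ, hσS, hσ⟩
  · simp [hempty]
  have : Fact (Module.finrank ℝ R3 = 2 + 1) := ⟨finrank_euclideanSpace_fin⟩
  have hsub : Metric.closedBall p r ⊆ Metric.closedBall σ c := by
    refine Metric.closedBall_subset_closedBall' ?_
    linarith [Metric.mem_closedBall'.1 hσ]
  calc μHE[2] (S ∩ Metric.closedBall p r)
      = μHE[2] (S ∩ Metric.closedBall σ c ∩ Metric.closedBall p r) := by
        rw [Set.inter_assoc, Set.inter_eq_right.2 hsub]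
    _ ≤ _ := (hflat S n h σ hσS).euclideanHausdorffMeasure_inter_closedBall_le (hn σ hσS) p hr

section BoundedRestrict

variable {X : Type*} [PseudoMetricSpace X] [MeasurableSpace X] [OpensMeasurableSpace X]
  {μ : Measure X} {S : Set X}

theorem restrict_closedBall_le_indicator {m : ℝ≥0∞} {δ : ℝ}
    (hm : ∀ p, μ.restrict S (Metric.closedBall p δ) ≤ m) (p : X) :
    μ.restrict S (Metric.closedBall p δ) ≤ (Metric.cthickening δ S).indicator (fun _ ↦ m) p := by
  by_cases hp : p ∈ Metric.cthickening δ S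
  · rw [Set.indicator_of_mem hp]
    exact hm p
  suffices Metric.closedBall p δ ∩ S = ∅ by
    rw [Measure.restrict_apply Metric.isClosed_closedBall.measurableSet, this, measure_empty]
    exact zero_le
  refine Set.eq_empty_of_forall_notMem fun σ hσ ↦ hp ?_
  exact Metric.mem_cthickening_of_dist_le p σ δ S hσ.2 (Metric.mem_closedBall'.1 hσ.1)

theorem isFiniteMeasure_restrict_of_isBounded [ProperSpace X] (hS : Bornology.IsBounded S) {c : ℝ}
    (hc : 0 < c) (h : ∀ p, μ.restrict S (Metric.closedBall p c) < ⊤) :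
    IsFiniteMeasure (μ.restrict S) := by
  have : IsLocallyFiniteMeasure (μ.restrict S) :=
    ⟨fun p ↦ ⟨_, Metric.closedBall_mem_nhds p hc, h p⟩⟩
  refine ⟨?_⟩
  have hsupp : μ.restrict S (closure S)ᶜ = 0 := by
    rw [Measure.restrict_apply isClosed_closure.measurableSet.compl, Set.inter_comm,
      ← Set.sdiff_eq, Set.sdiff_eq_empty.2 subset_closure, measure_empty]
  rw [← measure_add_measure_compl isClosed_closure.measurableSet, hsupp, add_zero]
  exact hS.isCompact_closure.measure_lt_top

end BoundedRestrict

section Convolution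

theorem sq_lintegral_mul_le {α : Type*} [MeasurableSpace α] (μ : Measure α) {F G : α → ℝ≥0∞}
    (hF : AEMeasurable F μ) (hG : AEMeasurable G μ) :
    (∫⁻ a, F a * G a ∂μ) ^ 2 ≤ (∫⁻ a, F a ^ 2 ∂μ) * ∫⁻ a, G a ^ 2 ∂μ := by
  have holder := ENNReal.lintegral_mul_le_Lp_mul_Lq μ Real.HolderConjugate.two_two hF hG
  simp only [Pi.mul_apply, ENNReal.rpow_ofNat] at holder
  calc (∫⁻ a, F a * G a ∂μ) ^ 2
      ≤ ((∫⁻ a, F a ^ 2 ∂μ) ^ (1 / 2 : ℝ) * (∫⁻ a, G a ^ 2 ∂μ) ^ (1 / 2 : ℝ)) ^ 2 := by gcongr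
    _ = (∫⁻ a, F a ^ 2 ∂μ) * ∫⁻ a, G a ^ 2 ∂μ := by
      rw [mul_pow, ← ENNReal.rpow_ofNat, ← ENNReal.rpow_ofNat, ← ENNReal.rpow_mul,
        ← ENNReal.rpow_mul]
      norm_num

theorem sq_conv_withDensity_le {M : Type*} [AddMonoid M] [MeasurableSpace M] [MeasurableAdd₂ M]
    {μ ν : Measure M} [SFinite μ] [SFinite ν] {F G : M → ℝ≥0∞} (hF : AEMeasurable F μ)
    (hG : AEMeasurable G ν) {B : Set M} (hB : MeasurableSet B) :
    ((μ.withDensity F) ∗ (ν.withDensity G)) B ^ 2 ≤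
      (∫⁻ x, F x ^ 2 * ν {y | x + y ∈ B} ∂μ) * ∫⁻ y, G y ^ 2 * μ {x | x + y ∈ B} ∂ν := by
  have hB' : MeasurableSet ((fun z : M × M ↦ z.1 + z.2) ⁻¹' B) := measurable_add hB
  have hF₁ : AEMeasurable (fun z : M × M ↦ F z.1) (μ.prod ν) := hF.comp_fst
  have hG₂ : AEMeasurable (fun z : M × M ↦ G z.2) (μ.prod ν) := hG.comp_snd
  rw [Measure.conv, prod_withDensity₀ hF hG, Measure.map_apply measurable_add hB,
    withDensity_apply _ hB']
  refine (sq_lintegral_mul_le _ hF₁.restrict hG₂.restrict).trans_eq ?_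
  rw [← lintegral_indicator hB', ← lintegral_indicator hB']
  congr 1
  · rw [lintegral_prod _ ((hF₁.pow_const 2).indicator hB')]
    refine lintegral_congr fun x ↦ ?_
    exact lintegral_indicator_const (measurable_const_add x hB) (F x ^ 2)
  · rw [lintegral_prod_symm _ ((hG₂.pow_const 2).indicator hB')]
    refine lintegral_congr fun y ↦ ?_
    exact lintegral_indicator_const (measurable_add_const y hB) (G y ^ 2)

variable {E : Type*} [NormedAddCommGroup E] [MeasurableSpace E] [BorelSpace E]

theorem lintegral_mul_measure_closedBall_sub_le {μ ν : Measure E} {W : E → ℝ≥0∞}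
    (hW : AEMeasurable W μ) {N : Set E} (hN : MeasurableSet N) {m : ℝ≥0∞} {δ : ℝ}
    (hν : ∀ p, ν (Metric.closedBall p δ) ≤ N.indicator (fun _ ↦ m) p) (v : E) :
    ∫⁻ x, W x * ν (Metric.closedBall (v - x) δ) ∂μ ≤ m * μ.withDensity W {x | v - x ∈ N} := by
  have hNv : MeasurableSet {x | v - x ∈ N} := measurable_const_sub v hN
  calc ∫⁻ x, W x * ν (Metric.closedBall (v - x) δ) ∂μ
      ≤ ∫⁻ x, {x | v - x ∈ N}.indicator (fun x ↦ m * W x) x ∂μ := by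
        gcongr with x
        refine (mul_le_mul_right (hν (v - x)) (W x)).trans_eq ?_
        by_cases hx : v - x ∈ N <;> simp [hx, mul_comm]
    _ = m * μ.withDensity W {x | v - x ∈ N} := by
        rw [lintegral_indicator hNv, withDensity_apply _ hNv,
          lintegral_const_mul'' m hW.restrict]

theorem sq_conv_withDensity_closedBall_le [SecondCountableTopology E] {μ ν : Measure E}
    [SFinite μ] [SFinite ν] {F G : E → ℝ≥0∞} (hF : AEMeasurable F μ) (hG : AEMeasurable G ν)
    {N₁ N₂ : Set E} (hN₁ : MeasurableSet N₁) (hN₂ : MeasurableSet N₂) {m : ℝ≥0∞} {δ : ℝ}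
    (hμ : ∀ p, μ (Metric.closedBall p δ) ≤ N₁.indicator (fun _ ↦ m) p)
    (hν : ∀ p, ν (Metric.closedBall p δ) ≤ N₂.indicator (fun _ ↦ m) p) (v : E) :
    ((μ.withDensity F) ∗ (ν.withDensity G)) (Metric.closedBall v δ) ^ 2 ≤
      m ^ 2 * (μ.withDensity (fun x ↦ F x ^ 2) {x | v - x ∈ N₂} *
        ν.withDensity (fun y ↦ G y ^ 2) {y | v - y ∈ N₁}) := by
  have preimage_add_left (x : E) :
      {y | x + y ∈ Metric.closedBall v δ} = Metric.closedBall (v - x) δ := by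
    ext y
    simp only [Set.mem_ofPred_eq, mem_closedBall_iff_norm, sub_sub_eq_add_sub, add_comm]
  have preimage_add_right (y : E) :
      {x | x + y ∈ Metric.closedBall v δ} = Metric.closedBall (v - y) δ := by
    simp only [← preimage_add_left, add_comm]
  calc ((μ.withDensity F) ∗ (ν.withDensity G)) (Metric.closedBall v δ) ^ 2
      ≤ (∫⁻ x, F x ^ 2 * ν (Metric.closedBall (v - x) δ) ∂μ) *
          ∫⁻ y, G y ^ 2 * μ (Metric.closedBall (v - y) δ) ∂ν := by
        simpa only [preimage_add_left, preimage_add_right] using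
          sq_conv_withDensity_le hF hG (Metric.isClosed_closedBall (x := v) (ε := δ)).measurableSet
    _ ≤ (m * μ.withDensity (fun x ↦ F x ^ 2) {x | v - x ∈ N₂}) *
          (m * ν.withDensity (fun y ↦ G y ^ 2) {y | v - y ∈ N₁}) :=
        mul_le_mul' (lintegral_mul_measure_closedBall_sub_le (hF.pow_const 2) hN₂ hν v)
          (lintegral_mul_measure_closedBall_sub_le (hG.pow_const 2) hN₁ hμ v)
    _ = m ^ 2 * (μ.withDensity (fun x ↦ F x ^ 2) {x | v - x ∈ N₂} *
          ν.withDensity (fun y ↦ G y ^ 2) {y | v - y ∈ N₁}) := by ring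

theorem lintegral_sq_conv_withDensity_closedBall_le [SecondCountableTopology E]
    {ρ μ ν : Measure E} [SFinite ρ] [SFinite μ] [SFinite ν] {F G : E → ℝ≥0∞}
    (hF : AEMeasurable F μ) (hG : AEMeasurable G ν) {N₁ N₂ : Set E} (hN₁ : MeasurableSet N₁)
    (hN₂ : MeasurableSet N₂) {m V : ℝ≥0∞} {δ : ℝ}
    (hμ : ∀ p, μ (Metric.closedBall p δ) ≤ N₁.indicator (fun _ ↦ m) p)
    (hν : ∀ p, ν (Metric.closedBall p δ) ≤ N₂.indicator (fun _ ↦ m) p)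
    (hV : ∀ x y, ρ {v | v - x ∈ N₂ ∧ v - y ∈ N₁} ≤ V) :
    ∫⁻ v, ((μ.withDensity F) ∗ (ν.withDensity G)) (Metric.closedBall v δ) ^ 2 ∂ρ ≤
      m ^ 2 * V * (∫⁻ x, F x ^ 2 ∂μ) * ∫⁻ y, G y ^ 2 ∂ν := by
  set μ' := μ.withDensity (fun x ↦ F x ^ 2)
  set ν' := ν.withDensity (fun y ↦ G y ^ 2)
  let D : Set (E × E × E) := {z | z.1 - z.2.1 ∈ N₂ ∧ z.1 - z.2.2 ∈ N₁}
  have hD : MeasurableSet D :=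
    ((measurable_fst.sub measurable_snd.fst) hN₂).inter
      ((measurable_fst.sub measurable_snd.snd) hN₁)
  calc ∫⁻ v, ((μ.withDensity F) ∗ (ν.withDensity G)) (Metric.closedBall v δ) ^ 2 ∂ρ
      ≤ ∫⁻ v, m ^ 2 * (μ'.prod ν') (Prod.mk v ⁻¹' D) ∂ρ := by
        gcongr with v
        refine (sq_conv_withDensity_closedBall_le hF hG hN₁ hN₂ hμ hν v).trans_eq ?_
        rw [← Measure.prod_prod]
        rfl
    _ = m ^ 2 * ∫⁻ z, ρ ((fun v ↦ (v, z)) ⁻¹' D) ∂(μ'.prod ν') := by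
        rw [lintegral_const_mul _ (measurable_measure_prodMk_left hD), ← Measure.prod_apply hD,
          Measure.prod_apply_symm hD]
    _ ≤ m ^ 2 * ∫⁻ _, V ∂(μ'.prod ν') := by
        gcongr with z
        exact hV z.1 z.2
    _ = m ^ 2 * V * (∫⁻ x, F x ^ 2 ∂μ) * ∫⁻ y, G y ^ 2 ∂ν := by
        rw [lintegral_const, ← Set.univ_prod_univ, Measure.prod_prod]
        simp only [μ', ν', withDensity_apply _ MeasurableSet.univ, Measure.restrict_univ]
        ring

end Convolution

section BallAverages

theorem sq_eLpNorm_two {α E : Type*} [MeasurableSpace α] [NormedAddCommGroup E] (μ : Measure α)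
    (f : α → E) : eLpNorm f 2 μ ^ 2 = ∫⁻ x, ‖f x‖ₑ ^ 2 ∂μ := by
  simpa using eLpNorm_nnreal_pow_eq_lintegral (μ := μ) (f := f) (p := 2) two_ne_zero

theorem measurable_measure_closedBall {X : Type*} [PseudoMetricSpace X]
    [SecondCountableTopology X] [MeasurableSpace X] [OpensMeasurableSpace X] (ν : Measure X)
    [SFinite ν] (δ : ℝ) : Measurable fun v ↦ ν (Metric.closedBall v δ) :=
  measurable_measure_prodMk_left (s := {z : X × X | dist z.2 z.1 ≤ δ})
    (measurableSet_le (measurable_snd.dist measurable_fst) measurable_const)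

theorem lintegral_measure_closedBall_comm {X : Type*} [PseudoMetricSpace X]
    [SecondCountableTopology X] [MeasurableSpace X] [OpensMeasurableSpace X] (μ ν : Measure X)
    [SFinite μ] [SFinite ν] (δ : ℝ) :
    ∫⁻ x, ν (Metric.closedBall x δ) ∂μ = ∫⁻ y, μ (Metric.closedBall y δ) ∂ν := by
  have hD : MeasurableSet {z : X × X | dist z.2 z.1 ≤ δ} :=
    measurableSet_le (measurable_snd.dist measurable_fst) measurable_const
  calc ∫⁻ x, ν (Metric.closedBall x δ) ∂μ = μ.prod ν {z | dist z.2 z.1 ≤ δ} :=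
        (Measure.prod_apply hD).symm
    _ = ∫⁻ y, μ (Metric.closedBall y δ) ∂ν := by
        rw [Measure.prod_apply_symm hD]
        exact lintegral_congr fun y ↦ congrArg μ (Set.ext fun x ↦ Metric.mem_closedBall'.symm)

variable {E : Type*} [NormedAddCommGroup E] [MeasurableSpace E]

/-- The averages of the measure `P` over balls of radius `δ` have square integral at most `K` over
`s`, for all small `δ > 0`. The inequality is multiplied by the square of the volume
`μ (closedBall 0 δ)` of these balls; it is meant for translation invariant `μ`. -/
def HasBallL2Bound (μ P : Measure E) (s : Set E) (K : ℝ≥0∞) : Prop :=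
  ∀ᶠ δ in 𝓝[>] (0 : ℝ),
    ∫⁻ v in s, P (Metric.closedBall v δ) ^ 2 ∂μ ≤ K * μ (Metric.closedBall 0 δ) ^ 2

theorem HasBallL2Bound.mono_set {μ P : Measure E} {s t : Set E} {K : ℝ≥0∞}
    (h : HasBallL2Bound μ P t K) (hst : s ⊆ t) : HasBallL2Bound μ P s K :=
  h.mono fun _ hδ ↦ (lintegral_mono_set hst).trans hδ

variable [NormedSpace ℝ E] [FiniteDimensional ℝ E] [BorelSpace E] {μ P : Measure E}
  [μ.IsAddHaarMeasure] [IsLocallyFiniteMeasure P] {s : Set E} {K : ℝ≥0∞}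

theorem HasBallL2Bound.lintegral_sq_rnDeriv_le (h : HasBallL2Bound μ P s K) :
    ∫⁻ v in s, P.rnDeriv μ v ^ 2 ∂μ ≤ K := by
  let average (δ : ℝ) (v : E) : ℝ≥0∞ :=
    (P (Metric.closedBall v δ) / μ (Metric.closedBall v δ)) ^ 2
  have differentiation : ∀ᵐ v ∂μ.restrict s,
      Filter.Tendsto (average · v) (𝓝[>] 0) (𝓝 (P.rnDeriv μ v ^ 2)) := by
    filter_upwards [ae_restrict_of_ae (Besicovitch.ae_tendsto_rnDeriv P μ)] with v hv
    exact ((ENNReal.continuous_pow 2).tendsto _).comp hv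
  have average_le : ∀ᶠ δ in 𝓝[>] 0, ∫⁻ v in s, average δ v ∂μ ≤ K := by
    filter_upwards [h] with δ hδ
    simp_rw [average, Measure.addHaar_closedBall_center μ _ δ, div_eq_mul_inv, mul_pow]
    rw [lintegral_mul_const _ ((measurable_measure_closedBall P δ).pow_const 2),
      ← ENNReal.inv_pow, ← div_eq_mul_inv]
    exact ENNReal.div_le_of_le_mul hδ
  calc ∫⁻ v in s, P.rnDeriv μ v ^ 2 ∂μ
      = ∫⁻ v in s, Filter.liminf (average · v) (𝓝[>] 0) ∂μ :=
        lintegral_congr_ae (differentiation.mono fun v hv ↦ hv.liminf_eq.symm)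
    _ ≤ Filter.liminf (fun δ ↦ ∫⁻ v in s, average δ v ∂μ) (𝓝[>] 0) :=
        lintegral_liminf_le fun δ ↦ ((measurable_measure_closedBall P δ).div
          (measurable_measure_closedBall μ δ)).pow_const 2
    _ ≤ K := (Filter.liminf_le_limsup).trans (Filter.limsup_le_of_le (h := average_le))

theorem HasBallL2Bound.sq_eLpNorm_le {F : Type*} [NormedAddCommGroup F] {f : E → F}
    (h : HasBallL2Bound μ P s K) (hf : ∀ᵐ v ∂μ, ‖f v‖ₑ ≤ P.rnDeriv μ v) :
    eLpNorm f 2 (μ.restrict s) ^ 2 ≤ K := by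
  rw [sq_eLpNorm_two]
  exact (lintegral_mono_ae (ae_restrict_of_ae (hf.mono fun v hv ↦ pow_le_pow_left' hv 2))).trans
    h.lintegral_sq_rnDeriv_le

theorem measure_mul_measure_closedBall_le_setLIntegral {A : Set E} (hA : MeasurableSet A) (δ : ℝ) :
    P A * μ (Metric.closedBall 0 δ) ≤
      ∫⁻ v in Metric.cthickening δ A, P (Metric.closedBall v δ) ∂μ := by
  calc P A * μ (Metric.closedBall 0 δ)
      = ∫⁻ p in A, μ (Metric.closedBall p δ) ∂P := by
        simp_rw [Measure.addHaar_closedBall_center μ _ δ, setLIntegral_const, mul_comm]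
    _ = ∫⁻ p in A, μ.restrict (Metric.cthickening δ A) (Metric.closedBall p δ) ∂P := by
        refine setLIntegral_congr_fun hA fun p hp ↦ ?_
        exact (Measure.restrict_eq_self _ (Metric.closedBall_subset_cthickening hp δ)).symm
    _ = ∫⁻ v in Metric.cthickening δ A, P.restrict A (Metric.closedBall v δ) ∂μ :=
        lintegral_measure_closedBall_comm _ _ δ
    _ ≤ ∫⁻ v in Metric.cthickening δ A, P (Metric.closedBall v δ) ∂μ :=
        lintegral_mono fun v ↦ Measure.restrict_apply_le A _

theorem HasBallL2Bound.sq_measure_le {A : Set E} (h : HasBallL2Bound μ P s K)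
    (hA : MeasurableSet A) (hs : ∀ᶠ δ in 𝓝[>] (0 : ℝ), Metric.cthickening δ A ⊆ s) :
    ∀ᶠ δ in 𝓝[>] (0 : ℝ), P A ^ 2 ≤ μ (Metric.cthickening δ A) * K := by
  filter_upwards [h, hs, self_mem_nhdsWithin] with δ hδ hδs (hδ₀ : 0 < δ)
  have ball_ne_zero : μ (Metric.closedBall 0 δ) ≠ 0 :=
    (Metric.measure_closedBall_pos μ 0 hδ₀).ne'
  have ball_ne_top : μ (Metric.closedBall 0 δ) ≠ ⊤ := measure_closedBall_lt_top.ne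
  rw [← ENNReal.mul_le_mul_iff_left (pow_ne_zero 2 ball_ne_zero) (ENNReal.pow_ne_top ball_ne_top),
    ← mul_pow, mul_assoc]
  calc (P A * μ (Metric.closedBall 0 δ)) ^ 2
      ≤ (∫⁻ v in Metric.cthickening δ A, 1 * P (Metric.closedBall v δ) ∂μ) ^ 2 := by
        simpa only [one_mul] using
          pow_le_pow_left' (measure_mul_measure_closedBall_le_setLIntegral hA δ) 2
    _ ≤ (∫⁻ _ in Metric.cthickening δ A, 1 ^ 2 ∂μ) *
          ∫⁻ v in Metric.cthickening δ A, P (Metric.closedBall v δ) ^ 2 ∂μ :=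
        sq_lintegral_mul_le _ aemeasurable_const (measurable_measure_closedBall P δ).aemeasurable
    _ ≤ μ (Metric.cthickening δ A) * (K * μ (Metric.closedBall 0 δ) ^ 2) := by
        rw [one_pow, setLIntegral_one]
        gcongr
        exact (lintegral_mono_set hδs).trans hδ

theorem absolutelyContinuous_of_hasBallL2Bound
    (h : ∀ R : ℝ, ∃ K : ℝ≥0∞, K ≠ ⊤ ∧ HasBallL2Bound μ P (Metric.closedBall 0 R) K) :
    P ≪ μ := by
  refine Measure.AbsolutelyContinuous.mk fun s hs hs₀ ↦ ?_
  rw [hs.measure_eq_iSup_isCompact P]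
  simp only [ENNReal.iSup_eq_zero]
  intro A hAs hA
  have hA₀ : μ A = 0 := measure_mono_null hAs hs₀
  obtain ⟨R, hR⟩ := (hA.isBounded.cthickening (δ := 1)).subset_closedBall 0
  obtain ⟨K, hK, hbound⟩ := h R
  have sq_le : ∀ᶠ δ in 𝓝[>] (0 : ℝ), P A ^ 2 ≤ μ (Metric.cthickening δ A) * K := by
    refine hbound.sq_measure_le hA.measurableSet ?_
    filter_upwards [Ioc_mem_nhdsGT one_pos] with δ hδ
    exact (Metric.cthickening_mono hδ.2 A).trans hR
  have tendsto_zero :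
      Filter.Tendsto (fun δ ↦ μ (Metric.cthickening δ A) * K) (𝓝[>] 0) (𝓝 0) := by
    have := (tendsto_measure_cthickening_of_isCompact (μ := μ) hA).mono_left
      (nhdsWithin_le_nhds (s := Set.Ioi 0))
    rw [hA₀] at this
    simpa only [zero_mul] using ENNReal.Tendsto.mul_const this (Or.inr hK)
  exact pow_eq_zero_iff two_ne_zero |>.1 (nonpos_iff_eq_zero.1 (ge_of_tendsto tendsto_zero sq_le))

end BallAverages

section Pushforward

open ProbabilityTheory

variable {X Y 𝕜 : Type*} [MeasurableSpace X] [MeasurableSpace Y] [RCLike 𝕜] {T : X → Y}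
  {Q : Measure X} {w : X → 𝕜}

theorem integral_integral_condDistrib_mul [IsFiniteMeasure Q] (hT : AEMeasurable T Q)
    (hw : AEMeasurable w Q) {ψ : Y → 𝕜} (hψ : Measurable ψ)
    (hwψ : Integrable (fun x ↦ w x * ψ (T x)) Q) :
    ∫ y, (∫ z, z ∂condDistrib w T Q y) * ψ y ∂(Q.map T) = ∫ x, w x * ψ (T x) ∂Q := by
  have hTw : AEMeasurable (fun x ↦ (T x, w x)) Q := hT.prodMk hw
  have hzψ : AEStronglyMeasurable (fun p : Y × 𝕜 ↦ p.2 * ψ p.1) (Q.map fun x ↦ (T x, w x)) :=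
    (measurable_snd.mul (hψ.comp measurable_fst)).aestronglyMeasurable
  have hzψ_int : Integrable (fun p : Y × 𝕜 ↦ p.2 * ψ p.1) (Q.map T ⊗ₘ condDistrib w T Q) := by
    rw [compProd_map_condDistrib hw]
    exact (integrable_map_measure hzψ hTw).2 hwψ
  calc ∫ y, (∫ z, z ∂condDistrib w T Q y) * ψ y ∂(Q.map T)
      = ∫ p, p.2 * ψ p.1 ∂(Q.map T ⊗ₘ condDistrib w T Q) := by
        rw [Measure.integral_compProd hzψ_int]
        simp_rw [integral_mul_const]
    _ = ∫ x, w x * ψ (T x) ∂Q := by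
        rw [compProd_map_condDistrib hw, integral_map hTw hzψ]

theorem ae_norm_integral_condDistrib_le [IsFiniteMeasure Q] (hT : AEMeasurable T Q)
    (hw : AEMeasurable w Q) {c : ℝ} (hc : ∀ᵐ x ∂Q, ‖w x‖ ≤ c) :
    ∀ᵐ y ∂Q.map T, ‖∫ z, z ∂condDistrib w T Q y‖ ≤ c := by
  have norm_le : ∀ᵐ p ∂(Q.map T ⊗ₘ condDistrib w T Q), ‖p.2‖ ≤ c := by
    rw [compProd_map_condDistrib hw, ae_map_iff (hT.prodMk hw)
      (measurableSet_le measurable_snd.norm measurable_const)]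
    exact hc
  filter_upwards [Measure.ae_ae_of_ae_compProd norm_le] with y hy
  simpa using norm_integral_le_of_norm_le_const hy

variable {ρ : Measure Y} [SigmaFinite ρ]

theorem exists_density_of_map_absolutelyContinuous [IsFiniteMeasure Q]
    (hT : AEMeasurable T Q) (hac : Q.map T ≪ ρ) (hw : AEMeasurable w Q)
    (hw_le : ∀ᵐ x ∂Q, ‖w x‖ ≤ 1) :
    ∃ h : Y → 𝕜, Integrable h ρ ∧ (∀ᵐ y ∂ρ, ‖h y‖ₑ ≤ (Q.map T).rnDeriv ρ y) ∧
      ∀ (ψ : Y → 𝕜) (M : ℝ), Measurable ψ → (∀ y, ‖ψ y‖ ≤ M) →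
        ∫ y, h y * ψ y ∂ρ = ∫ x, w x * ψ (T x) ∂Q := by
  let mean (y : Y) : 𝕜 := ∫ z, z ∂condDistrib w T Q y
  have mean_meas : StronglyMeasurable mean :=
    (measurable_snd (α := Y) (β := 𝕜)).stronglyMeasurable.integral_condDistrib
  refine ⟨fun y ↦ ((Q.map T).rnDeriv ρ y).toReal • mean y, ?_, ?_, fun ψ M hψ hM ↦ ?_⟩
  · refine (integrable_rnDeriv_smul_iff hac).2 ?_
    exact Integrable.of_bound mean_meas.aestronglyMeasurable 1
      (ae_norm_integral_condDistrib_le hT hw hw_le)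
  · have mean_le := ae_norm_integral_condDistrib_le hT hw hw_le
    rw [← Measure.withDensity_rnDeriv_eq _ _ hac,
      ae_withDensity_iff (Measure.measurable_rnDeriv _ _)] at mean_le
    filter_upwards [mean_le, (Q.map T).rnDeriv_lt_top ρ] with y hy hy_top
    rcases eq_or_ne ((Q.map T).rnDeriv ρ y) 0 with hzero | hzero
    · simp [hzero]
    · rw [enorm_smul, ← ofReal_norm, Real.norm_of_nonneg ENNReal.toReal_nonneg,
        ENNReal.ofReal_toReal hy_top.ne, ← ofReal_norm]
      exact mul_le_of_le_one_right' (ENNReal.ofReal_le_one.2 (hy hzero))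
  · have hwψ : Integrable (fun x ↦ w x * ψ (T x)) Q :=
      (Integrable.of_bound hw.aestronglyMeasurable 1 hw_le).mul_bdd (c := M)
        (hψ.comp_aemeasurable hT).aestronglyMeasurable (ae_of_all _ fun x ↦ hM (T x))
    simp_rw [smul_mul_assoc]
    rw [integral_rnDeriv_smul hac, integral_integral_condDistrib_mul hT hw hψ hwψ]

theorem exists_density_of_map_withDensity_enorm_absolutelyContinuous {π : Measure X} {u : X → 𝕜}
    (hT : Measurable T) (hu : Integrable u π) (hac : (π.withDensity (‖u ·‖ₑ)).map T ≪ ρ) :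
    ∃ h : Y → 𝕜, Integrable h ρ ∧
      (∀ᵐ y ∂ρ, ‖h y‖ₑ ≤ ((π.withDensity (‖u ·‖ₑ)).map T).rnDeriv ρ y) ∧
      ∀ (ψ : Y → 𝕜) (M : ℝ), Measurable ψ → (∀ y, ‖ψ y‖ ≤ M) →
        ∫ y, h y * ψ y ∂ρ = ∫ x, u x * ψ (T x) ∂π := by
  have : IsFiniteMeasure (π.withDensity (‖u ·‖ₑ)) :=
    isFiniteMeasure_withDensity hu.hasFiniteIntegral.ne
  let sign (x : X) : 𝕜 := (‖u x‖⁻¹ : ℝ) • u x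
  have sign_meas : AEMeasurable sign (π.withDensity (‖u ·‖ₑ)) :=
    (hu.1.aemeasurable.norm.inv.smul hu.1.aemeasurable).mono_ac
      (withDensity_absolutelyContinuous _ _)
  have sign_le (x : X) : ‖sign x‖ ≤ 1 := by
    rw [norm_smul, norm_inv, norm_norm]
    exact inv_mul_le_one
  obtain ⟨h, h_int, h_le, h_eq⟩ :=
    exists_density_of_map_absolutelyContinuous hT.aemeasurable hac sign_meas (ae_of_all _ sign_le)
  refine ⟨h, h_int, h_le, fun ψ M hψ hM ↦ ?_⟩
  rw [h_eq ψ M hψ hM, integral_withDensity_eq_integral_toReal_smul₀ hu.1.enorm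
    (ae_of_all _ fun x ↦ enorm_lt_top)]
  refine integral_congr_ae (ae_of_all _ fun x ↦ ?_)
  rcases eq_or_ne (u x) 0 with hux | hux
  · simp [hux, sign]
  · simp only [sign, toReal_enorm, ← smul_mul_assoc, smul_smul]
    rw [mul_inv_cancel₀ (norm_ne_zero_iff.2 hux), one_smul]

end Pushforward

theorem exists_density_conv_withDensity {M 𝕜 : Type*} [AddMonoid M] [MeasurableSpace M]
    [MeasurableAdd₂ M] [RCLike 𝕜] {μ ν ρ : Measure M} [SFinite μ] [SFinite ν] [SigmaFinite ρ]
    {f g : M → 𝕜} (hf : Integrable f μ) (hg : Integrable g ν)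
    (hac : (μ.withDensity (‖f ·‖ₑ)) ∗ (ν.withDensity (‖g ·‖ₑ)) ≪ ρ) :
    ∃ h : M → 𝕜, Integrable h ρ ∧
      (∀ᵐ v ∂ρ, ‖h v‖ₑ ≤ ((μ.withDensity (‖f ·‖ₑ)) ∗ (ν.withDensity (‖g ·‖ₑ))).rnDeriv ρ v) ∧
      ∀ (ψ : M → 𝕜) (R : ℝ), Measurable ψ → (∀ v, ‖ψ v‖ ≤ R) →
        ∫ v, h v * ψ v ∂ρ = ∫ x, ∫ y, f x * g y * ψ (x + y) ∂ν ∂μ := by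
  have conv_eq : (μ.withDensity (‖f ·‖ₑ)) ∗ (ν.withDensity (‖g ·‖ₑ)) =
      ((μ.prod ν).withDensity (fun z ↦ ‖f z.1 * g z.2‖ₑ)).map (fun z ↦ z.1 + z.2) := by
    simp_rw [Measure.conv, prod_withDensity₀ hf.1.enorm hg.1.enorm, enorm_mul]
  have hfg : Integrable (fun z : M × M ↦ f z.1 * g z.2) (μ.prod ν) := hf.mul_prod hg
  rw [conv_eq] at hac ⊢
  obtain ⟨h, h_int, h_le, h_eq⟩ :=
    exists_density_of_map_withDensity_enorm_absolutelyContinuous measurable_add hfg hac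
  refine ⟨h, h_int, h_le, fun ψ R hψ hR ↦ (h_eq ψ R hψ hR).trans (integral_prod _ ?_)⟩
  exact hfg.mul_bdd (c := R) (hψ.comp measurable_add).aestronglyMeasurable
    (ae_of_all _ fun z ↦ hR _)

theorem NormalHolder.isFiniteMeasure_surfaceMeasure {β b : ℝ} {S : Set R3} {n : R3 → R3}
    (h : NormalHolder β b S n) (hβ : 0 < β) (hn : ∀ σ ∈ S, ‖n σ‖ = 1)
    (hS : Bornology.IsBounded S) : IsFiniteMeasure (surfaceMeasure S) := by
  obtain ⟨c, hc, K, -, hK⟩ := exists_surfaceMeasure_closedBall_le hβ b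
  exact isFiniteMeasure_restrict_of_isBounded hS hc fun p ↦
    (hK S n h hn p c hc.le le_rfl).trans_lt ENNReal.ofReal_lt_top

theorem ofReal_mul_pow_six_eq_mul_sq_volume_closedBall {A δ : ℝ} (hA : 0 ≤ A) (hδ : 0 ≤ δ) :
    ENNReal.ofReal (A * δ ^ 6) =
      ENNReal.ofReal (A / (Real.pi * 4 / 3) ^ 2) * volume (Metric.closedBall (0 : R3) δ) ^ 2 := by
  rw [EuclideanSpace.volume_closedBall_fin_three, ← ENNReal.ofReal_pow hδ,
    ← ENNReal.ofReal_mul (by positivity), ← ENNReal.ofReal_pow (by positivity),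
    ← ENNReal.ofReal_mul (by positivity)]
  congr 1
  field_simp

namespace TransversalTriple

variable {β b θ D : ℝ} {S : Fin 3 → Set R3} {n : Fin 3 → R3 → R3}

theorem isFiniteMeasure_surfaceMeasure (h : TransversalTriple β b θ D S n) (hβ : 0 < β)
    (i : Fin 3) : IsFiniteMeasure (surfaceMeasure (S i)) :=
  (h.holder i).isFiniteMeasure_surfaceMeasure hβ (h.norm_eq_one i) (h.isBounded i)

theorem exists_hasBallL2Bound (hβ : 0 < β) (hθ : 0 < θ) (b D : ℝ) :
    ∃ K : ℝ, 0 ≤ K ∧ ∀ (S : Fin 3 → Set R3) (n : Fin 3 → R3 → R3),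
      TransversalTriple β b θ D S n → ∀ F G : R3 → ℝ≥0∞, AEMeasurable F (surfaceMeasure (S 0)) →
        AEMeasurable G (surfaceMeasure (S 1)) → ∀ ε > 0,
          HasBallL2Bound volume
            (((surfaceMeasure (S 0)).withDensity F) ∗ ((surfaceMeasure (S 1)).withDensity G))
            (Metric.cthickening ε (S 2))
            (ENNReal.ofReal (K * ε) * (∫⁻ x, F x ^ 2 ∂surfaceMeasure (S 0)) *
              ∫⁻ y, G y ^ 2 ∂surfaceMeasure (S 1)) := by
  obtain ⟨c, hc, A, hA₀, hA⟩ := NormalHolder.exists_surfaceMeasure_closedBall_le hβ b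
  obtain ⟨B, hB₀, hB⟩ := exists_volume_translates_le hβ hθ b D
  refine ⟨A ^ 2 * B / (Real.pi * 4 / 3) ^ 2, by positivity, fun S n h F G hF hG ε hε ↦ ?_⟩
  have := h.isFiniteMeasure_surfaceMeasure hβ 0
  have := h.isFiniteMeasure_surfaceMeasure hβ 1
  filter_upwards [Ioc_mem_nhdsGT (lt_min hc hε)] with δ ⟨hδ, hδ_le⟩
  have hδc : δ ≤ c := hδ_le.trans (min_le_left _ _)
  have hball (i : Fin 3) (p : R3) :
      surfaceMeasure (S i) (Metric.closedBall p δ) ≤ ENNReal.ofReal (A * δ ^ 2) :=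
    hA (S i) (n i) (h.holder i) (h.norm_eq_one i) p δ hδ.le hδc
  have hslices (x y : R3) : volume.restrict (Metric.cthickening ε (S 2))
      {v | v - x ∈ Metric.cthickening δ (S 1) ∧ v - y ∈ Metric.cthickening δ (S 0)} ≤
        ENNReal.ofReal (B * ε * δ ^ 2) := by
    rw [Measure.restrict_apply' Metric.isClosed_cthickening.measurableSet]
    refine (measure_mono fun v hv ↦ ?_).trans
      (hB S n h ![y, x, 0] 2 ε δ hδ (hδ_le.trans (min_le_right _ _)))
    refine ⟨by simpa using hv.2, fun i hi ↦ ?_⟩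
    fin_cases i
    exacts [hv.1.2, hv.1.1, absurd rfl hi]
  refine (lintegral_sq_conv_withDensity_closedBall_le hF hG
    Metric.isClosed_cthickening.measurableSet Metric.isClosed_cthickening.measurableSet
    (restrict_closedBall_le_indicator (hball 0)) (restrict_closedBall_le_indicator (hball 1))
    hslices).trans_eq ?_
  have scaling : ENNReal.ofReal (A * δ ^ 2) ^ 2 * ENNReal.ofReal (B * ε * δ ^ 2) =
      ENNReal.ofReal (A ^ 2 * B / (Real.pi * 4 / 3) ^ 2 * ε) *
        volume (Metric.closedBall (0 : R3) δ) ^ 2 := by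
    rw [div_mul_eq_mul_div, ← ofReal_mul_pow_six_eq_mul_sq_volume_closedBall (by positivity) hδ.le,
      ← ENNReal.ofReal_pow (by positivity), ← ENNReal.ofReal_mul (by positivity)]
    congr 1
    ring
  rw [scaling]
  ring

theorem absolutelyContinuous_conv_withDensity_enorm (h : TransversalTriple β b θ D S n)
    (hβ : 0 < β) (hθ : 0 < θ) (hne : (S 2).Nonempty) {f g : R3 → ℂ}
    (hf : MemLp f 2 (surfaceMeasure (S 0))) (hg : MemLp g 2 (surfaceMeasure (S 1))) :
    ((surfaceMeasure (S 0)).withDensity (‖f ·‖ₑ)) ∗ ((surfaceMeasure (S 1)).withDensity (‖g ·‖ₑ)) ≪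
      volume := by
  obtain ⟨K, -, hK⟩ := exists_hasBallL2Bound hβ hθ b D
  obtain ⟨s, hs⟩ := hne
  have := h.isFiniteMeasure_surfaceMeasure hβ 0
  have := h.isFiniteMeasure_surfaceMeasure hβ 1
  have := isFiniteMeasure_withDensity (hf.integrable one_le_two).2.ne
  have := isFiniteMeasure_withDensity (hg.integrable one_le_two).2.ne
  refine absolutelyContinuous_of_hasBallL2Bound fun R ↦
    ⟨_, ?_, (hK S n h _ _ hf.1.enorm hg.1.enorm (max (R + ‖s‖) 1) (by positivity)).mono_set ?_⟩
  · simp_rw [← sq_eLpNorm_two]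
    exact ENNReal.mul_ne_top (ENNReal.mul_ne_top ENNReal.ofReal_ne_top
      (ENNReal.pow_ne_top hf.2.ne)) (ENNReal.pow_ne_top hg.2.ne)
  · refine fun v hv ↦ Metric.mem_cthickening_of_dist_le v s _ _ hs ?_
    refine ((dist_le_norm_add_norm v s).trans ?_).trans (le_max_left _ _)
    gcongr
    exact mem_closedBall_zero_iff.1 hv

end TransversalTriple

theorem mainTheorem2_general {β θ : ℝ} (hβ : 0 < β) (hθ : 0 < θ) (b D : ℝ) :
    ∃ C : ℝ, 0 < C ∧ ∀ (S : Fin 3 → Set R3) (n : Fin 3 → R3 → R3),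
      TransversalTriple β b θ D S n → (S 2).Nonempty → ∀ f g : R3 → ℂ,
        MemLp f 2 (surfaceMeasure (S 0)) → MemLp g 2 (surfaceMeasure (S 1)) →
          ∃ h : R3 → ℂ, IsSurfaceConvolution (S 0) (S 1) f g h ∧ ∀ ε : ℝ, 0 < ε →
            eLpNorm h 2 (volume.restrict (Metric.cthickening ε (S 2))) ≤
              ENNReal.ofReal (C * √ε) * eLpNorm f 2 (surfaceMeasure (S 0)) *
                eLpNorm g 2 (surfaceMeasure (S 1)) := by
  obtain ⟨K, hK₀, hK⟩ := TransversalTriple.exists_hasBallL2Bound hβ hθ b D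
  refine ⟨√K + 1, by positivity, fun S n hS hne f g hf hg ↦ ?_⟩
  have := hS.isFiniteMeasure_surfaceMeasure hβ 0
  have := hS.isFiniteMeasure_surfaceMeasure hβ 1
  have hf₁ := hf.integrable one_le_two
  have hg₁ := hg.integrable one_le_two
  have := isFiniteMeasure_withDensity hf₁.2.ne
  have := isFiniteMeasure_withDensity hg₁.2.ne
  obtain ⟨h, h_int, h_le, h_eq⟩ := exists_density_conv_withDensity hf₁ hg₁
    (hS.absolutelyContinuous_conv_withDensity_enorm hβ hθ hne hf hg)
  refine ⟨h, ⟨h_int, fun ψ hψ hψ_supp ↦ ?_⟩, fun ε hε ↦ ?_⟩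
  · obtain ⟨R, hR⟩ := hψ.continuous.bounded_above_of_compact_support hψ_supp
    exact h_eq ψ R hψ.continuous.measurable hR
  · rw [← ENNReal.pow_le_pow_left_iff two_ne_zero]
    calc eLpNorm h 2 (volume.restrict (Metric.cthickening ε (S 2))) ^ 2
        ≤ ENNReal.ofReal (K * ε) * (∫⁻ x, ‖f x‖ₑ ^ 2 ∂surfaceMeasure (S 0)) *
            ∫⁻ y, ‖g y‖ₑ ^ 2 ∂surfaceMeasure (S 1) :=
          (hK S n hS _ _ hf.1.enorm hg.1.enorm ε hε).sq_eLpNorm_le h_le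
      _ ≤ ENNReal.ofReal (((√K + 1) * √ε) ^ 2) * (∫⁻ x, ‖f x‖ₑ ^ 2 ∂surfaceMeasure (S 0)) *
            ∫⁻ y, ‖g y‖ₑ ^ 2 ∂surfaceMeasure (S 1) := by
          gcongr
          rw [mul_pow, Real.sq_sqrt hε.le]
          gcongr
          nlinarith [Real.sq_sqrt hK₀, Real.sqrt_nonneg K]
      _ = (ENNReal.ofReal ((√K + 1) * √ε) * eLpNorm f 2 (surfaceMeasure (S 0)) *
            eLpNorm g 2 (surfaceMeasure (S 1))) ^ 2 := by
          rw [ENNReal.ofReal_pow (by positivity), ← sq_eLpNorm_two, ← sq_eLpNorm_two, mul_pow,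
            mul_pow]

theorem mainTheorem2 (β : ℝ) (hβ0 : 0 < β) (hβ1 : β ≤ 1) :
    ∃ C : ℝ, 0 < C ∧
      ∀ (S S' : Fin 3 → Set R3) (n : Fin 3 → R3 → R3),
        SurfaceAssumption β 1 (1 / 2) S S' n →
        (∀ i, Metric.diam (S i) ≤ 1) →
        (S 2).Nonempty →
        ∀ f g : R3 → ℂ,
          MemLp f 2 (surfaceMeasure (S 0)) → MemLp g 2 (surfaceMeasure (S 1)) →
          ∃ h : R3 → ℂ, IsSurfaceConvolution (S 0) (S 1) f g h ∧
            ∀ ε : ℝ, 0 < ε → ε ≤ 1 →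
              eLpNorm h 2 (volume.restrict (Metric.cthickening ε (S 2))) ≤
                ENNReal.ofReal (C * √ε) * eLpNorm f 2 (surfaceMeasure (S 0)) *
                  eLpNorm g 2 (surfaceMeasure (S 1)) := by
  obtain ⟨C, hC, h⟩ := mainTheorem2_general hβ0 one_half_pos 1 1
  refine ⟨C, hC, fun S S' n hS hdiam hne f g hf hg ↦ ?_⟩
  obtain ⟨k, hk, hbound⟩ := h S n (hS.transversalTriple hdiam) hne f g hf hg
  exact ⟨k, hk, fun ε hε _ ↦ hbound ε hε⟩
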